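/- Let $n,k\ge 0$, let $M^n$ be a smooth Hausdorff $n$-manifold without boundary, and let $F: M^n\to\mathbb{R}^{n+k}$ be a smooth immersion. Give $M$ the induced metric $g_{ij}=\langle \partial_iF,\partial_jF\rangle$, let $d$ be the associated intrinsic distance (the infimum of the lengths of $C^1$ paths, $d=\infty$ between different connected components), let $A(v,w)=(D_vD_wF)^\perp$ be the second fundamental form, $H=g^{ij}A(\partial_i,\partial_j)$ the mean curvature vector, $\nabla_vH=(D_vH)^\perp$ its derivative with respect to the normal connection, and $|\nabla H|^2=g^{ij}\langle\nabla_iH,\nabla_jH\rangle$. Suppose there are constants $c^\#>0$ and $H^\#>0$ such that $$|\nabla H(p)|\le c^\#|H(p)|^2\qquad\text{for every } p\in M \text{ with } |H(p)|\ge H^\#.$$ Let $p_0\in M$ satisfy $|H(p_0)|\ge\gamma H^\#$ for some $\gamma>1$. Then $$|H(q)|\ \ge\ \frac{|H(p_0)|}{1+c^\#\,d(p_0,q)\,|H(p_0)|}\ \ge\ \frac{|H(p_0)|}{\gamma}$$ for all $q\in M$ with $d(p_0,q)\le\dfrac{\gamma-1}{c^\#}\,\dfrac{1}{|H(p_0)|}$.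 -/

import Mathlib

open scoped Manifold ContDiff

noncomputable section

namespace ImmersedSubmanifold

/- Throughout, `M` is an `n`-manifold (modelled on `ℝⁿ`, no boundary) and `F : M → ℝᵐ`.
Mathlib's tangent space of `M` at `p` is `ℝⁿ`, identified through the preferred chart at `p`; the
standard basis vectors of `ℝⁿ` are therefore the coordinate vectors `∂ᵢ` of that chart. -/
variable (n : ℕ) {m : ℕ} {M : Type*} [TopologicalSpace M] [ChartedSpace (EuclideanSpace ℝ (Fin n)) M]

/-- The coordinate tangent vector `∂ᵢ` at `p`, in the preferred chart at `p`. -/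
def coordVec (p : M) (i : Fin n) : TangentSpace (𝓡 n) p :=
  (EuclideanSpace.single i (1 : ℝ) : EuclideanSpace ℝ (Fin n))

/-- The differential `dF_p : T_p M → ℝᵐ`. -/
def differential (F : M → EuclideanSpace ℝ (Fin m)) (p : M) :
    TangentSpace (𝓡 n) p →L[ℝ] EuclideanSpace ℝ (Fin m) :=
  mfderiv (𝓡 n) 𝓘(ℝ, EuclideanSpace ℝ (Fin m)) F p

/-- The tangent plane `dF_p (T_p M) ⊆ ℝᵐ` of the immersed submanifold. -/
def tangentPlane (F : M → EuclideanSpace ℝ (Fin m)) (p : M) :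
    Submodule ℝ (EuclideanSpace ℝ (Fin m)) :=
  LinearMap.range (differential n F p).toLinearMap

/-- The orthogonal projection of `ℝᵐ` onto the normal space `(dF_p (T_p M))ᗮ`. -/
def normalProj (F : M → EuclideanSpace ℝ (Fin m)) (p : M) :
    EuclideanSpace ℝ (Fin m) →L[ℝ] EuclideanSpace ℝ (Fin m) :=
  (tangentPlane n F p)ᗮ.starProjection

/-- The induced metric `g_{ij} = ⟨dF ∂ᵢ, dF ∂ⱼ⟩` at `p`. -/
def inducedMetric (F : M → EuclideanSpace ℝ (Fin m)) (p : M) : Matrix (Fin n) (Fin n) ℝ :=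
  Matrix.of fun i j => inner ℝ (differential n F p (coordVec n p i)) (differential n F p (coordVec n p j))

/-- The (vector valued) second fundamental form `A_p(v, w) = (D_v D_w F)^⊥`, computed in the
preferred chart at `p`: the normal part of the second derivative of `F` read in that chart. -/
def secondFundamentalForm (F : M → EuclideanSpace ℝ (Fin m)) (p : M)
    (v w : TangentSpace (𝓡 n) p) : EuclideanSpace ℝ (Fin m) :=
  normalProj n F p
    (fderiv ℝ (fderiv ℝ (F ∘ (extChartAt (𝓡 n) p).symm)) (extChartAt (𝓡 n) p p) v w)

/-- The mean curvature vector `H = g^{ij} A(∂ᵢ, ∂ⱼ)`, the trace of the second fundamental form. -/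
def meanCurvature (F : M → EuclideanSpace ℝ (Fin m)) (p : M) : EuclideanSpace ℝ (Fin m) :=
  ∑ i : Fin n, ∑ j : Fin n,
    (inducedMetric n F p)⁻¹ i j • secondFundamentalForm n F p (coordVec n p i) (coordVec n p j)

/-- The normal connection `∇_v ν = (D_v ν)^⊥`, for a normal field `ν` along `F`. -/
def normalDeriv (F ν : M → EuclideanSpace ℝ (Fin m)) (p : M) (v : TangentSpace (𝓡 n) p) :
    EuclideanSpace ℝ (Fin m) :=
  normalProj n F p (differential n ν p v)

/-- The norm `|∇H|`, where `|∇H|² = g^{ij} ⟨∇ᵢ H, ∇ⱼ H⟩`. -/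
def normGradMeanCurvature (F : M → EuclideanSpace ℝ (Fin m)) (p : M) : ℝ :=
  √(∑ i : Fin n, ∑ j : Fin n, (inducedMetric n F p)⁻¹ i j *
    inner ℝ (normalDeriv n F (meanCurvature n F) p (coordVec n p i))
      (normalDeriv n F (meanCurvature n F) p (coordVec n p j)))

/-- The intrinsic distance of the metric induced by `F`: the infimum of the lengths of `C¹` paths,
where a tangent vector `v` at `x` has length `|dF_x v|`. It is `∞` for two points of different
connected components. -/
def intrinsicEDist (F : M → EuclideanSpace ℝ (Fin m)) (p q : M) : ENNReal :=
  letI : ∀ x : M, ENorm (TangentSpace (𝓡 n) x) := fun x => ⟨fun v => ‖differential n F x v‖ₑ⟩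
  Manifold.riemannianEDist (𝓡 n) p q

end ImmersedSubmanifold

end

/-!
Along a curve, `|H|` decreases at rate at most `c |H|²` per unit of arc length as long as
`|H| ≥ Hs`: since `H` is normal, `⟨H, D_v H⟩ = ⟨H, ∇_v H⟩`, and `|∇_v H| ≤ |∇H| |v|`
(`abs_inner_differential_meanCurvature_le`). Hence `1 / |H| - c s` is nonincreasing in the arc length
`s`, which gives `|H| ≥ |H(p₀)| / (1 + c s |H(p₀)|)`. While `s < (γ - 1) / (c |H(p₀)|)`, this bound is
larger than `|H(p₀)| / γ ≥ Hs`, so the condition `|H| ≥ Hs` never fails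
(`norm_le_norm_mul_of_abs_inner_deriv_le`).

This needs `H` to be differentiable, although it is defined at each point in a chart that varies with
the point. The mean curvature in coordinates, `flatMeanCurvature`, is invariant under changes of
coordinates (`flatMeanCurvature_comp`), so near a point `H` can be computed in one fixed chart
(`meanCurvature_eq_flatMeanCurvature`), where its differentiability is seen from a formula with the
inverse of the metric.

The distance need not be attained by a curve, and at the critical distance `(γ - 1) / (c |H(p₀)|)` the
comparison does not reach the endpoint of curves that are slightly too long. So almost shortest curves
are stopped slightly early. The points reached converge to `q` in the topology of `M`, because `F`
does not increase distances and is locally injective (`exists_forall_path_mem`), and the bound at `q`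
follows by continuity of `H` (`exists_near_norm_meanCurvature_ge`).
-/

namespace ImmersedSubmanifold

/-! ### Traces with respect to an induced metric -/

section LinearAlgebra

variable {ι E W Z : Type*} [Fintype ι] [DecidableEq ι] [AddCommGroup E] [Module ℝ E]
  [NormedAddCommGroup W] [InnerProductSpace ℝ W] [AddCommGroup Z] [Module ℝ Z]

/-- The trace `g^{ij} C(bᵢ, bⱼ)` of a bilinear map with respect to the metric `g = L^*⟨·,·⟩` does not
depend on the basis. No injectivity of `L` is needed: under a change of basis `P` the Gram matrix
becomes `Pᵀ G P`, and inverting this is legitimate, in Mathlib's convention, even if `G` is singular. -/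
theorem sum_inv_gram_smul_eq (L : E →ₗ[ℝ] W) (C : E →ₗ[ℝ] E →ₗ[ℝ] Z)
    (b b' : Module.Basis ι ℝ E) :
    ∑ i, ∑ j, (Matrix.gram ℝ (L ∘ b'))⁻¹ i j • C (b' i) (b' j)
      = ∑ i, ∑ j, (Matrix.gram ℝ (L ∘ b))⁻¹ i j • C (b i) (b j) := by
  set P := b.toMatrix b' with hP
  have hb' : ∀ i, b' i = ∑ k, P k i • b k := fun i => (b.sum_toMatrix_smul_self b' i).symm
  have hG : Matrix.gram ℝ (L ∘ b') = P.transpose * Matrix.gram ℝ (L ∘ b) * P := by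
    ext i j
    simp only [Matrix.gram_apply, Function.comp_apply, hb', map_sum, map_smul, sum_inner,
      inner_sum, Matrix.mul_apply, Matrix.transpose_apply, Finset.sum_mul,
      real_inner_smul_left, real_inner_smul_right]
    refine Finset.sum_congr rfl fun k _ => Finset.sum_congr rfl fun l _ => by ring
  have hPu : IsUnit P.det := by
    have h := b.toMatrix_mul_toMatrix_flip b'
    exact Matrix.isUnit_det_of_right_inverse h
  have hinv : P * (Matrix.gram ℝ (L ∘ b'))⁻¹ * P.transpose = (Matrix.gram ℝ (L ∘ b))⁻¹ := by
    have hPt : IsUnit P.transpose.det := by rwa [Matrix.det_transpose]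
    rw [hG, Matrix.mul_inv_rev, Matrix.mul_inv_rev, ← Matrix.mul_assoc, ← Matrix.mul_assoc,
      Matrix.mul_nonsing_inv _ hPu, Matrix.one_mul, Matrix.mul_assoc,
      Matrix.nonsing_inv_mul _ hPt, Matrix.mul_one]
  rw [← hinv]
  set Q := (Matrix.gram ℝ (L ∘ b'))⁻¹
  have hl : ∀ i j, Q i j • C (b' i) (b' j)
      = ∑ k, ∑ l, (P k i * Q i j * P l j) • C (b k) (b l) := by
    intro i j
    rw [hb' i, hb' j]
    simp only [map_sum, map_smul, LinearMap.sum_apply, LinearMap.smul_apply, Finset.smul_sum,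
      smul_smul]
    rw [Finset.sum_comm]
    refine Finset.sum_congr rfl fun k _ => Finset.sum_congr rfl fun l _ => ?_
    congr 1; ring
  have hr : ∀ k l, (P * Q * P.transpose) k l • C (b k) (b l)
      = ∑ i, ∑ j, (P k i * Q i j * P l j) • C (b k) (b l) := by
    intro k l
    simp only [Matrix.mul_apply, Matrix.transpose_apply, Finset.sum_mul, Finset.sum_smul]
    rw [Finset.sum_comm]
  simp only [hl, hr]
  calc _ = ∑ i, ∑ k, ∑ j, ∑ l, (P k i * Q i j * P l j) • C (b k) (b l) :=
        Finset.sum_congr rfl fun i _ => Finset.sum_comm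
    _ = ∑ k, ∑ i, ∑ j, ∑ l, (P k i * Q i j * P l j) • C (b k) (b l) := Finset.sum_comm
    _ = ∑ k, ∑ i, ∑ l, ∑ j, (P k i * Q i j * P l j) • C (b k) (b l) :=
        Finset.sum_congr rfl fun k _ => Finset.sum_congr rfl fun i _ => Finset.sum_comm
    _ = _ := Finset.sum_congr rfl fun k _ => Finset.sum_comm

/-- The projection onto the normal space in terms of the inverse Gram matrix. It shows that this
projection depends differentiably on the vectors `v`. -/
theorem starProjection_orthogonal_span_eq [FiniteDimensional ℝ W] {v : ι → W}
    (hv : (Matrix.gram ℝ v).det ≠ 0) (w : W) :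
    (Submodule.span ℝ (Set.range v))ᗮ.starProjection w
      = w - ∑ i, ∑ j, ((Matrix.gram ℝ v)⁻¹ i j * inner ℝ (v i) w) • v j := by
  have hmem : ∀ j, v j ∈ Submodule.span ℝ (Set.range v) :=
    fun j => Submodule.subset_span ⟨j, rfl⟩
  refine (Submodule.eq_starProjection_of_mem_orthogonal (K := (Submodule.span ℝ (Set.range v))ᗮ)
    ?_ ?_)
  · rw [Submodule.mem_orthogonal]
    intro u hu
    induction hu using Submodule.span_induction with
    | mem x hx =>
      obtain ⟨k, rfl⟩ := hx
      simp only [inner_sub_right, inner_sum, real_inner_smul_right]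
      have h1 : ∑ i, ∑ j, (Matrix.gram ℝ v)⁻¹ i j * inner ℝ (v i) w * inner ℝ (v k) (v j)
          = ∑ i, ((Matrix.gram ℝ v)⁻¹ * Matrix.gram ℝ v) i k * inner ℝ (v i) w := by
        refine Finset.sum_congr rfl fun i _ => ?_
        rw [Matrix.mul_apply, Finset.sum_mul]
        refine Finset.sum_congr rfl fun j _ => ?_
        rw [Matrix.gram_apply, real_inner_comm (v j) (v k)]; ring
      rw [h1, Matrix.nonsing_inv_mul _ (isUnit_iff_ne_zero.2 hv)]
      simp [Matrix.one_apply]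
    | zero => simp
    | add x y _ _ hx hy => rw [inner_add_left, hx, hy, add_zero]
    | smul a x _ hx => rw [real_inner_smul_left, hx, mul_zero]
  · rw [sub_sub_cancel, Submodule.orthogonal_orthogonal]
    exact Submodule.sum_mem _ fun i _ => Submodule.sum_mem _ fun j _ =>
      Submodule.smul_mem _ _ (hmem j)

/-- The operator norm with respect to the metric `L^*⟨·,·⟩` is at most the Hilbert–Schmidt norm.
The latter is a trace, so it can be computed in a basis which `L` maps to an orthonormal one. -/
theorem norm_le_sqrt_sum_inv_gram_mul {V : Type*} [NormedAddCommGroup V] [InnerProductSpace ℝ V]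
    (L : E →ₗ[ℝ] W) (hL : Function.Injective L) (B : E →ₗ[ℝ] V) (b : Module.Basis ι ℝ E) (v : E) :
    ‖B v‖ ≤ √(∑ i, ∑ j, (Matrix.gram ℝ (L ∘ b))⁻¹ i j * inner ℝ (B (b i)) (B (b j))) * ‖L v‖ := by
  have : FiniteDimensional ℝ E := b.finiteDimensional_of_finite
  let e := LinearEquiv.ofInjective L hL
  let o₀ := stdOrthonormalBasis ℝ (LinearMap.range L)
  let r : Fin (Module.finrank ℝ (LinearMap.range L)) ≃ ι :=
    o₀.toBasis.indexEquiv (b.map e)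
  let o := o₀.reindex r
  let u : Module.Basis ι ℝ E := o.toBasis.map e.symm
  have hLu : ∀ i, L (u i) = (o i : W) := by
    intro i
    have : (e (u i) : W) = (o i : W) := by simp [u]
    simpa [e] using this
  have hgram : Matrix.gram ℝ (L ∘ u) = 1 := by
    ext i j
    rw [Matrix.gram_apply, Function.comp_apply, Function.comp_apply, hLu, hLu,
      ← Submodule.coe_inner, Matrix.one_apply]
    exact orthonormal_iff_ite.1 o.orthonormal i j
  have htr := sum_inv_gram_smul_eq L ((innerₗ V).compl₁₂ B B) u b
  rw [hgram, inv_one] at htr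
  have htr' : ∑ i, ∑ j, (Matrix.gram ℝ (L ∘ b))⁻¹ i j * inner ℝ (B (b i)) (B (b j))
      = ∑ i, ‖B (u i)‖ ^ 2 := by
    refine Eq.trans (by simpa using htr) ?_
    simp [Matrix.one_apply]
  rw [htr']
  have hv : v = ∑ i, u.repr v i • u i := (u.sum_repr v).symm
  have hnL : ‖L v‖ = √(∑ i, (u.repr v i) ^ 2) := by
    have h1 : ‖L v‖ = ‖e v‖ := by simp [e]
    have h2 : ∀ i, u.repr v i = o.repr (e v) i := by
      intro i
      simp [u]
    rw [h1, ← o.repr.norm_map, EuclideanSpace.norm_eq]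
    simp [h2]
  have h3 : ‖B v‖ ≤ ∑ i, ‖B (u i)‖ * |u.repr v i| := by
    conv_lhs => rw [hv]
    rw [map_sum]
    refine (norm_sum_le _ _).trans (Finset.sum_le_sum fun i _ => ?_)
    rw [map_smul, norm_smul, Real.norm_eq_abs, mul_comm]
  rw [hnL]
  refine h3.trans ((Real.sum_mul_le_sqrt_mul_sqrt _ _ _).trans_eq ?_)
  simp

end LinearAlgebra

/-! ### The mean curvature in coordinates -/

section Flat

theorem differentiableAt_matrix_det {ι X : Type*} [Fintype ι] [DecidableEq ι]
    [NormedAddCommGroup X] [NormedSpace ℝ X] {A : X → Matrix ι ι ℝ} {x : X}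
    (hA : ∀ i j, DifferentiableAt ℝ (fun y => A y i j) x) :
    DifferentiableAt ℝ (fun y => (A y).det) x := by
  simp only [Matrix.det_apply, Units.smul_def, zsmul_eq_mul]
  exact DifferentiableAt.fun_sum fun σ _ => (differentiableAt_const _).mul
    (HasFDerivAt.finsetProd fun i _ => (hA (σ i) i).hasFDerivAt).differentiableAt

theorem differentiableAt_matrix_inv {ι X : Type*} [Fintype ι] [DecidableEq ι]
    [NormedAddCommGroup X] [NormedSpace ℝ X] {A : X → Matrix ι ι ℝ} {x : X}
    (hA : ∀ i j, DifferentiableAt ℝ (fun y => A y i j) x) (hx : (A x).det ≠ 0) (i j : ι) :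
    DifferentiableAt ℝ (fun y => (A y)⁻¹ i j) x := by
  simp only [Matrix.inv_def, Ring.inverse_eq_inv', Matrix.smul_apply, smul_eq_mul,
    Matrix.adjugate_apply]
  refine ((differentiableAt_matrix_det hA).inv hx).mul (differentiableAt_matrix_det fun a b => ?_)
  simp only [Matrix.updateRow_apply]
  split_ifs
  · exact differentiableAt_const _
  · exact hA a b

variable {n m : ℕ}

/-- The mean curvature vector at `x` of the map `f` between Euclidean spaces, in the standard
coordinates of the source: `g^{ij} (∂ᵢ∂ⱼ f)^⊥`. -/
noncomputable def flatMeanCurvature (f : EuclideanSpace ℝ (Fin n) → EuclideanSpace ℝ (Fin m))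
    (x : EuclideanSpace ℝ (Fin n)) : EuclideanSpace ℝ (Fin m) :=
  ∑ i : Fin n, ∑ j : Fin n,
    (Matrix.gram ℝ (fderiv ℝ f x ∘ fun i => EuclideanSpace.single i (1 : ℝ)))⁻¹ i j •
      (LinearMap.range (fderiv ℝ f x).toLinearMap)ᗮ.starProjection
        (fderiv ℝ (fderiv ℝ f) x (EuclideanSpace.single i 1) (EuclideanSpace.single j 1))

theorem flatMeanCurvature_congr {f g : EuclideanSpace ℝ (Fin n) → EuclideanSpace ℝ (Fin m)}
    {x : EuclideanSpace ℝ (Fin n)} (h : f =ᶠ[nhds x] g) :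
    flatMeanCurvature f x = flatMeanCurvature g x := by
  simp only [flatMeanCurvature, h.fderiv_eq, h.fderiv.fderiv_eq]

theorem fderiv_fderiv_comp_apply {X Y Z : Type*} [NormedAddCommGroup X] [NormedSpace ℝ X]
    [NormedAddCommGroup Y] [NormedSpace ℝ Y] [NormedAddCommGroup Z] [NormedSpace ℝ Z]
    {f : Y → Z} {τ : X → Y} {x : X}
    (hf : ContDiffAt ℝ 2 f (τ x)) (hτ : ContDiffAt ℝ 2 τ x) (v w : X) :
    fderiv ℝ (fderiv ℝ (f ∘ τ)) x v w
      = fderiv ℝ (fderiv ℝ f) (τ x) (fderiv ℝ τ x v) (fderiv ℝ τ x w)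
        + fderiv ℝ f (τ x) (fderiv ℝ (fderiv ℝ τ) x v w) := by
  have hev : fderiv ℝ (f ∘ τ) =ᶠ[nhds x] fun y => (fderiv ℝ f (τ y)).comp (fderiv ℝ τ y) := by
    filter_upwards [hτ.eventually (by simp), hτ.continuousAt.eventually (hf.eventually (by simp))]
      with y hy hfy
    exact fderiv_comp y (hfy.differentiableAt (by simp)) (hy.differentiableAt (by simp))
  have hf' : DifferentiableAt ℝ (fderiv ℝ f) (τ x) :=
    (hf.fderiv_right (m := 1) (by norm_num)).differentiableAt (by simp)
  have hτ' : DifferentiableAt ℝ (fderiv ℝ τ) x :=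
    (hτ.fderiv_right (m := 1) (by norm_num)).differentiableAt (by simp)
  have h1 := (hf'.hasFDerivAt.comp x (hτ.differentiableAt (by simp)).hasFDerivAt).clm_comp
    hτ'.hasFDerivAt
  rw [hev.fderiv_eq]
  erw [h1.fderiv]
  simp [add_comm]

/-- The mean curvature vector is invariant under reparametrization by `τ`. The second derivative of
`f ∘ τ` differs from the pullback of that of `f` by `Df (D²τ)`, which is tangential, and what remains
is the trace of the same bilinear map in another basis. -/
theorem flatMeanCurvature_comp {f : EuclideanSpace ℝ (Fin n) → EuclideanSpace ℝ (Fin m)}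
    {τ : EuclideanSpace ℝ (Fin n) → EuclideanSpace ℝ (Fin n)} {x : EuclideanSpace ℝ (Fin n)}
    (hf : ContDiffAt ℝ 2 f (τ x)) (hτ : ContDiffAt ℝ 2 τ x)
    (hinj : Function.Injective (fderiv ℝ τ x)) :
    flatMeanCurvature (f ∘ τ) x = flatMeanCurvature f (τ x) := by
  have hd : fderiv ℝ (f ∘ τ) x = (fderiv ℝ f (τ x)).comp (fderiv ℝ τ x) :=
    fderiv_comp x (hf.differentiableAt (by simp)) (hτ.differentiableAt (by simp))
  have hbij : Function.Bijective (fderiv ℝ τ x) :=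
    ⟨hinj, LinearMap.surjective_of_injective (f := (fderiv ℝ τ x).toLinearMap) hinj⟩
  let T : EuclideanSpace ℝ (Fin n) ≃ₗ[ℝ] EuclideanSpace ℝ (Fin n) :=
    LinearEquiv.ofBijective (fderiv ℝ τ x).toLinearMap hbij
  let b : Module.Basis (Fin n) ℝ (EuclideanSpace ℝ (Fin n)) :=
    (EuclideanSpace.basisFun (Fin n) ℝ).toBasis
  have hb : ∀ i, b i = EuclideanSpace.single i (1 : ℝ) := fun i => by simp [b]
  have hrange : LinearMap.range (fderiv ℝ (f ∘ τ) x).toLinearMap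
      = LinearMap.range (fderiv ℝ f (τ x)).toLinearMap := by
    rw [hd]
    exact LinearMap.range_comp_of_range_eq_top _ (LinearMap.range_eq_top.2 hbij.2)
  let P := (LinearMap.range (fderiv ℝ f (τ x)).toLinearMap)ᗮ.starProjection
  have hP : ∀ v, P (fderiv ℝ f (τ x) v) = 0 := fun v =>
    Submodule.starProjection_orthogonal_apply_eq_zero ⟨v, rfl⟩
  let C : EuclideanSpace ℝ (Fin n) →ₗ[ℝ] EuclideanSpace ℝ (Fin n) →ₗ[ℝ] EuclideanSpace ℝ (Fin m) :=
    LinearMap.mk₂ ℝ (fun v w => P (fderiv ℝ (fderiv ℝ f) (τ x) v w))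
      (by simp) (by simp) (by simp) (by simp)
  have key := sum_inv_gram_smul_eq (fderiv ℝ f (τ x)).toLinearMap C b (b.map T)
  have h1 : (fderiv ℝ (f ∘ τ) x ∘ fun i => EuclideanSpace.single i (1 : ℝ))
      = (fderiv ℝ f (τ x)).toLinearMap ∘ b.map T := by
    ext1 i
    simp [hd, hb, T]
  have h2 : (fderiv ℝ f (τ x) ∘ fun i => EuclideanSpace.single i (1 : ℝ))
      = (fderiv ℝ f (τ x)).toLinearMap ∘ b := by
    ext1 i
    simp [hb]
  unfold flatMeanCurvature
  simp only [hrange, h1, h2]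
  convert key using 1
  · refine Finset.sum_congr rfl fun i _ => Finset.sum_congr rfl fun j _ => ?_
    congr 1
    · rw [fderiv_fderiv_comp_apply hf hτ, map_add]
      erw [hP]
      simp [C, P, T, hb]
  · refine Finset.sum_congr rfl fun i _ => Finset.sum_congr rfl fun j _ => ?_
    simp [C, P, hb]

theorem differentiableAt_flatMeanCurvature {f : EuclideanSpace ℝ (Fin n) → EuclideanSpace ℝ (Fin m)}
    {x : EuclideanSpace ℝ (Fin n)}
    (hf : ContDiffAt ℝ 3 f x) (hinj : Function.Injective (fderiv ℝ f x)) :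
    DifferentiableAt ℝ (flatMeanCurvature f) x := by
  let v : EuclideanSpace ℝ (Fin n) → Fin n → EuclideanSpace ℝ (Fin m) := fun y =>
    fderiv ℝ f y ∘ fun i => EuclideanSpace.single i (1 : ℝ)
  have hf' : ContDiffAt ℝ 2 (fderiv ℝ f) x := hf.fderiv_right (by norm_num)
  have hf'' : ContDiffAt ℝ 1 (fderiv ℝ (fderiv ℝ f)) x := hf'.fderiv_right (by norm_num)
  have hv : ∀ i, DifferentiableAt ℝ (fun y => v y i) x := fun i =>
    (hf'.differentiableAt (by simp)).clm_apply (differentiableAt_const _)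
  have hG : ∀ i j, DifferentiableAt ℝ (fun y => Matrix.gram ℝ (v y) i j) x := fun i j => by
    simp only [Matrix.gram_apply]
    exact (hv i).inner ℝ (hv j)
  have hli : LinearIndependent ℝ (v x) := by
    have hb : v x = (fderiv ℝ f x).toLinearMap ∘ (EuclideanSpace.basisFun (Fin n) ℝ).toBasis := by
      ext1 i
      simp [v]
    rw [hb]
    exact (EuclideanSpace.basisFun (Fin n) ℝ).toBasis.linearIndependent.map' _
      (LinearMap.ker_eq_bot.2 hinj)
  have hdet : (Matrix.gram ℝ (v x)).det ≠ 0 :=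
    (Matrix.posDef_gram_of_linearIndependent hli).det_pos.ne'
  have hdet' : ∀ᶠ y in nhds x, (Matrix.gram ℝ (v y)).det ≠ 0 :=
    (differentiableAt_matrix_det hG).continuousAt.eventually_ne hdet
  have hspan : ∀ y, LinearMap.range (fderiv ℝ f y).toLinearMap
      = Submodule.span ℝ (Set.range (v y)) := by
    intro y
    rw [LinearMap.range_eq_map, ← (EuclideanSpace.basisFun (Fin n) ℝ).toBasis.span_eq,
      Submodule.map_span, ← Set.range_comp]
    congr 2
    ext1 i
    simp [v]
  have hGi := differentiableAt_matrix_inv hG hdet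
  have hD : ∀ i j, DifferentiableAt ℝ (fun y => fderiv ℝ (fderiv ℝ f) y
      (EuclideanSpace.single i (1 : ℝ)) (EuclideanSpace.single j (1 : ℝ))) x := fun i j =>
    ((hf''.differentiableAt (by simp)).clm_apply (differentiableAt_const _)).clm_apply
      (differentiableAt_const _)
  have hev : flatMeanCurvature f =ᶠ[nhds x] fun y => ∑ i : Fin n, ∑ j : Fin n,
      (Matrix.gram ℝ (v y))⁻¹ i j •
        (fderiv ℝ (fderiv ℝ f) y (EuclideanSpace.single i 1) (EuclideanSpace.single j 1)
          - ∑ k, ∑ l, ((Matrix.gram ℝ (v y))⁻¹ k l * inner ℝ (v y k) (fderiv ℝ (fderiv ℝ f) y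
            (EuclideanSpace.single i 1) (EuclideanSpace.single j 1))) • v y l) := by
    filter_upwards [hdet'] with y hy
    unfold flatMeanCurvature
    simp only [hspan y, starProjection_orthogonal_span_eq hy]
    rfl
  refine DifferentiableAt.congr_of_eventuallyEq ?_ hev
  exact DifferentiableAt.fun_sum fun i _ => DifferentiableAt.fun_sum fun j _ =>
    (hGi i j).smul ((hD i j).sub (DifferentiableAt.fun_sum fun k _ =>
      DifferentiableAt.fun_sum fun l _ => ((hGi k l).mul ((hv k).inner ℝ (hD i j))).smul (hv l)))

end Flat

/-! ### The mean curvature of an immersed manifold -/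

section Manifold

variable {n m : ℕ} {M : Type*} [TopologicalSpace M]
    [ChartedSpace (EuclideanSpace ℝ (Fin n)) M]

/-- In the charts adapted to an immersion, `F` is the inclusion `u ↦ (u, 0)`. -/
theorem immersion_normalForm {F : M → EuclideanSpace ℝ (Fin m)} {p : M}
    (h : Manifold.IsImmersionAt (𝓡 n) 𝓘(ℝ, EuclideanSpace ℝ (Fin m)) ∞ F p) {x : M}
    (hx : x ∈ h.domChart.source) :
    h.equiv.symm (h.codChart.extend 𝓘(ℝ, EuclideanSpace ℝ (Fin m)) (F x))
      = (h.domChart.extend (𝓡 n) x, 0) := by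
  have hxA : x ∈ (h.domChart.extend (𝓡 n)).source := by simpa using hx
  have h1 := h.writtenInCharts ((h.domChart.extend (𝓡 n)).map_source hxA)
  simp only [Function.comp_apply] at h1
  rw [(h.domChart.extend (𝓡 n)).left_inv hxA] at h1
  rw [h1, ContinuousLinearEquiv.symm_apply_apply]

theorem exists_nhds_injOn {F : M → EuclideanSpace ℝ (Fin m)} {p : M}
    (h : Manifold.IsImmersionAt (𝓡 n) 𝓘(ℝ, EuclideanSpace ℝ (Fin m)) ∞ F p) :
    ∃ U ∈ nhds p, Set.InjOn F U := by
  refine ⟨h.domChart.source, h.domChart.open_source.mem_nhds h.mem_domChart_source, ?_⟩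
  intro x hx y hy hxy
  have h1 := immersion_normalForm h hx
  rw [hxy, immersion_normalForm h hy] at h1
  exact (h.domChart.extend (𝓡 n)).injOn (by simpa using hx) (by simpa using hy)
    (congrArg Prod.fst h1).symm

theorem injective_mfderiv_of_isImmersionAt [IsManifold (𝓡 n) ∞ M]
    {F : M → EuclideanSpace ℝ (Fin m)} {p : M}
    (h : Manifold.IsImmersionAt (𝓡 n) 𝓘(ℝ, EuclideanSpace ℝ (Fin m)) ∞ F p) :
    Function.Injective (mfderiv (𝓡 n) 𝓘(ℝ, EuclideanSpace ℝ (Fin m)) F p) := by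
  set A := h.domChart.extend (𝓡 n) with hA
  set B := h.codChart.extend 𝓘(ℝ, EuclideanSpace ℝ (Fin m)) with hB
  have hp := h.mem_domChart_source
  have hpA : p ∈ A.source := by simpa [hA] using hp
  have hBd : MDifferentiableAt 𝓘(ℝ, EuclideanSpace ℝ (Fin m)) 𝓘(ℝ, EuclideanSpace ℝ (Fin m)) B
      (F p) :=
    (h.codChart.contMDiffAt_extend h.codChart_mem_maximalAtlas
      h.mem_codChart_source).mdifferentiableAt (by simp)
  have hq : (h.equiv.symm (B (F p))).1 = A p := by
    rw [hB, immersion_normalForm h hp]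
  have hAd : MDifferentiableAt 𝓘(ℝ, EuclideanSpace ℝ (Fin n)) (𝓡 n) A.symm
      (h.equiv.symm (B (F p))).1 := by
    rw [hq]
    refine ((contMDiffOn_extend_symm h.domChart_mem_maximalAtlas).contMDiffAt ?_).mdifferentiableAt
      (by simp)
    rw [← h.domChart.extend_target']
    exact h.domChart.isOpen_extend_target.mem_nhds (A.map_source hpA)
  have hl : MDifferentiableAt 𝓘(ℝ, EuclideanSpace ℝ (Fin m)) 𝓘(ℝ, EuclideanSpace ℝ (Fin n))
      (fun w => (h.equiv.symm w).1) (B (F p)) := by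
    rw [mdifferentiableAt_iff_differentiableAt]
    fun_prop
  -- the first component of the normal form, followed by the inverse chart, is a left inverse of `F`
  have hG := hAd.comp (F p) (hl.comp (F p) hBd)
  have hFd : MDifferentiableAt (𝓡 n) 𝓘(ℝ, EuclideanSpace ℝ (Fin m)) F p :=
    h.contMDiffAt.mdifferentiableAt (by simp)
  have hid : (A.symm ∘ (fun w => (h.equiv.symm w).1) ∘ B) ∘ F =ᶠ[nhds p] id := by
    filter_upwards [h.domChart.open_source.mem_nhds hp] with x hx
    simp only [Function.comp_apply, hB, immersion_normalForm h hx]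
    exact A.left_inv (by simpa [hA] using hx)
  have hc := mfderiv_comp p hG hFd
  rw [hid.mfderiv_eq, mfderiv_id] at hc
  intro v w hvw
  have hv := congrArg (fun L => L v) hc
  have hw := congrArg (fun L => L w) hc
  simp only [ContinuousLinearMap.comp_apply] at hv hw
  rw [hvw] at hv
  exact hv.trans hw.symm

theorem differential_eq_fderiv {F : M → EuclideanSpace ℝ (Fin m)} {p : M}
    (hF : MDifferentiableAt (𝓡 n) 𝓘(ℝ, EuclideanSpace ℝ (Fin m)) F p) :
    differential n F p = fderiv ℝ (F ∘ (extChartAt (𝓡 n) p).symm) (extChartAt (𝓡 n) p p) := by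
  rw [differential, hF.mfderiv]
  simp only [writtenInExtChartAt, modelWithCornersSelf_coe, Set.range_id, fderivWithin_univ]
  rfl

theorem meanCurvature_eq_flatMeanCurvature_self {F : M → EuclideanSpace ℝ (Fin m)} {p : M}
    (hF : MDifferentiableAt (𝓡 n) 𝓘(ℝ, EuclideanSpace ℝ (Fin m)) F p) :
    meanCurvature n F p
      = flatMeanCurvature (F ∘ (extChartAt (𝓡 n) p).symm) (extChartAt (𝓡 n) p p) := by
  have h := differential_eq_fderiv hF
  simp only [meanCurvature, secondFundamentalForm, inducedMetric, normalProj, tangentPlane, h]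
  rfl

variable [IsManifold (𝓡 n) ∞ M]

theorem contDiffAt_comp_extChartAt_symm {F : M → EuclideanSpace ℝ (Fin m)}
    (hF : ContMDiff (𝓡 n) 𝓘(ℝ, EuclideanSpace ℝ (Fin m)) ∞ F) {p₀ p : M}
    (hp : p ∈ (extChartAt (𝓡 n) p₀).source) :
    ContDiffAt ℝ ∞ (F ∘ (extChartAt (𝓡 n) p₀).symm) (extChartAt (𝓡 n) p₀ p) := by
  rw [← contMDiffAt_iff_contDiffAt]
  refine (hF.contMDiffAt).comp _ ((contMDiffOn_extChartAt_symm p₀).contMDiffAt ?_)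
  exact extChartAt_target_mem_nhds' ((extChartAt (𝓡 n) p₀).map_source hp)

theorem contDiffAt_extChartAt_comp_symm {p₀ p : M} (hp : p ∈ (extChartAt (𝓡 n) p₀).source) {p₁ : M}
    (hp₁ : p ∈ (extChartAt (𝓡 n) p₁).source) :
    ContDiffAt ℝ ∞ (extChartAt (𝓡 n) p₁ ∘ (extChartAt (𝓡 n) p₀).symm) (extChartAt (𝓡 n) p₀ p) := by
  have h := contDiffWithinAt_ext_coord_change (I := 𝓡 n) (n := ∞) p₁ p₀
    (y := extChartAt (𝓡 n) p₀ p) ?_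
  · simpa only [modelWithCornersSelf_coe, Set.range_id, contDiffWithinAt_univ] using h
  · rw [PartialEquiv.trans_source]
    refine ⟨(extChartAt (𝓡 n) p₀).map_source hp, ?_⟩
    rw [Set.mem_preimage, (extChartAt (𝓡 n) p₀).left_inv hp]
    exact hp₁

/-- `meanCurvature n F p` uses the preferred chart at `p`, which may jump as `p` varies; near `p₀` it
is also given by the formula in the single chart at `p₀`. -/
theorem meanCurvature_eq_flatMeanCurvature {F : M → EuclideanSpace ℝ (Fin m)}
    (hF : ContMDiff (𝓡 n) 𝓘(ℝ, EuclideanSpace ℝ (Fin m)) ∞ F) {p₀ p : M}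
    (hp : p ∈ (extChartAt (𝓡 n) p₀).source) :
    meanCurvature n F p
      = flatMeanCurvature (F ∘ (extChartAt (𝓡 n) p₀).symm) (extChartAt (𝓡 n) p₀ p) := by
  rw [meanCurvature_eq_flatMeanCurvature_self (hF.mdifferentiableAt (by simp))]
  set e := extChartAt (𝓡 n) p
  set e₀ := extChartAt (𝓡 n) p₀
  have hpe : p ∈ e.source := mem_extChartAt_source p
  have hτp : (e₀ ∘ e.symm) (e p) = e₀ p := by simp [e.left_inv hpe]
  have htgt : ∀ᶠ y in nhds (e p), e.symm y ∈ e₀.source := by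
    have hc : ContinuousAt e.symm (e p) := continuousAt_extChartAt_symm p
    refine hc.eventually ?_
    rw [e.left_inv hpe]
    exact extChartAt_source_mem_nhds' hp
  have hev : F ∘ e.symm =ᶠ[nhds (e p)] (F ∘ e₀.symm) ∘ (e₀ ∘ e.symm) := by
    filter_upwards [htgt] with y hy
    simp [e₀.left_inv hy]
  have hτ : ContDiffAt ℝ ∞ (e₀ ∘ e.symm) (e p) := contDiffAt_extChartAt_comp_symm hpe hp
  have hσ : ContDiffAt ℝ ∞ (e ∘ e₀.symm) (e₀ p) := contDiffAt_extChartAt_comp_symm hp hpe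
  have hf : ContDiffAt ℝ ∞ (F ∘ e₀.symm) (e₀ p) := contDiffAt_comp_extChartAt_symm hF hp
  have h2 : (2 : ℕ∞ω) ≤ ∞ :=
    WithTop.coe_le_coe.2 (le_top : (2 : ℕ∞) ≤ ⊤)
  have hid : (e ∘ e₀.symm) ∘ (e₀ ∘ e.symm) =ᶠ[nhds (e p)] id := by
    filter_upwards [htgt, extChartAt_target_mem_nhds (I := 𝓡 n) p] with y hy hy'
    simp [e₀.left_inv hy, e.right_inv hy']
  have hchain := fderiv_comp (e p) (g := e ∘ e₀.symm) (f := e₀ ∘ e.symm)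
    (by rw [hτp]; exact hσ.differentiableAt (by simp)) (hτ.differentiableAt (by simp))
  rw [hid.fderiv_eq, fderiv_id] at hchain
  have hinj : Function.Injective (fderiv ℝ (e₀ ∘ e.symm) (e p)) :=
    Function.LeftInverse.injective (g := fderiv ℝ (e ∘ e₀.symm) ((e₀ ∘ e.symm) (e p)))
      fun v => (congrArg (fun L => L v) hchain).symm
  rw [flatMeanCurvature_congr hev,
    flatMeanCurvature_comp (by rw [hτp]; exact hf.of_le h2) (hτ.of_le h2) hinj, hτp]

theorem mdifferentiableAt_meanCurvature {F : M → EuclideanSpace ℝ (Fin m)}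
    (hF : Manifold.IsImmersion (𝓡 n) 𝓘(ℝ, EuclideanSpace ℝ (Fin m)) ∞ F) (p : M) :
    MDifferentiableAt (𝓡 n) 𝓘(ℝ, EuclideanSpace ℝ (Fin m)) (meanCurvature n F) p := by
  have hFs := hF.contMDiff
  have hinj := injective_mfderiv_of_isImmersionAt (hF.isImmersionAt p)
  have hd := differential_eq_fderiv (hFs.mdifferentiableAt (x := p) (by simp))
  rw [differential] at hd
  rw [hd] at hinj
  have h3 : (3 : ℕ∞ω) ≤ ∞ :=
    WithTop.coe_le_coe.2 (le_top : (3 : ℕ∞) ≤ ⊤)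
  have hflat := differentiableAt_flatMeanCurvature
    ((contDiffAt_comp_extChartAt_symm hFs (mem_extChartAt_source p)).of_le h3) hinj
  have hcomp := hflat.mdifferentiableAt.comp p
    (mdifferentiableAt_extChartAt (I := 𝓡 n) (mem_chart_source _ p))
  refine hcomp.congr_of_eventuallyEq ?_
  filter_upwards [extChartAt_source_mem_nhds (I := 𝓡 n) p] with q hq
  exact meanCurvature_eq_flatMeanCurvature hFs hq

omit [IsManifold (𝓡 n) ∞ M] in
theorem normalProj_meanCurvature (F : M → EuclideanSpace ℝ (Fin m)) (p : M) :
    normalProj n F p (meanCurvature n F p) = meanCurvature n F p := by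
  refine Submodule.starProjection_eq_self_iff.2 ?_
  exact Submodule.sum_mem _ fun i _ => Submodule.sum_mem _ fun j _ =>
    Submodule.smul_mem _ _ (Submodule.starProjection_apply_mem _ _)

/-- Since `H` is normal, only the normal part of `D_v H` contributes to `⟨H, D_v H⟩`, whence
`|⟨H, D_v H⟩| ≤ |H| |∇H| |v|_g`. -/
theorem abs_inner_differential_meanCurvature_le {F : M → EuclideanSpace ℝ (Fin m)}
    (hF : Manifold.IsImmersion (𝓡 n) 𝓘(ℝ, EuclideanSpace ℝ (Fin m)) ∞ F) (p : M)
    (v : TangentSpace (𝓡 n) p) :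
    |inner ℝ (meanCurvature n F p) (differential n (meanCurvature n F) p v)|
      ≤ ‖meanCurvature n F p‖ * (normGradMeanCurvature n F p * ‖differential n F p v‖) := by
  have hinj := injective_mfderiv_of_isImmersionAt (hF.isImmersionAt p)
  let L : EuclideanSpace ℝ (Fin n) →ₗ[ℝ] EuclideanSpace ℝ (Fin m) :=
    (differential n F p).toLinearMap
  let B : EuclideanSpace ℝ (Fin n) →ₗ[ℝ] EuclideanSpace ℝ (Fin m) :=
    ((normalProj n F p).comp (differential n (meanCurvature n F) p)).toLinearMap
  let b : Module.Basis (Fin n) ℝ (EuclideanSpace ℝ (Fin n)) :=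
    (EuclideanSpace.basisFun (Fin n) ℝ).toBasis
  have hb : ⇑b = fun i => EuclideanSpace.single i (1 : ℝ) := by ext1 i; simp [b]
  have hB : ‖B v‖ ≤ normGradMeanCurvature n F p * ‖differential n F p v‖ := by
    have h := norm_le_sqrt_sum_inv_gram_mul L hinj B b v
    rw [hb] at h
    exact h
  rw [← normalProj_meanCurvature]
  have hsymm : inner ℝ (normalProj n F p (meanCurvature n F p))
        (differential n (meanCurvature n F) p v) = inner ℝ (meanCurvature n F p) (B v) :=
    Submodule.inner_starProjection_left_eq_right _ _ _
  rw [hsymm, normalProj_meanCurvature]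
  exact (abs_real_inner_le_norm _ _).trans (mul_le_mul_of_nonneg_left hB (norm_nonneg _))

end Manifold

/-! ### Comparison along curves and confinement of curves -/

section Comparison

/-- A comparison argument: if `|N|' ≥ -c |N|² s'` as long as `|N| ≥ Hs`, then `1 / |N| - c s` is
nonincreasing there, and the resulting bound keeps `|N|` above `Hs` while `1 + c s |N 0| < γ`. -/
theorem norm_le_norm_mul_of_abs_inner_deriv_le {V : Type*} [NormedAddCommGroup V]
    [InnerProductSpace ℝ V] {N N' : ℝ → V} {s s' : ℝ → ℝ} {T c Hs γ : ℝ}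
    (hN : ∀ t, HasDerivAt N (N' t) t) (hs : ∀ t, HasDerivAt s (s' t) t) (hs0 : s 0 = 0)
    (hs' : ∀ t, 0 ≤ s' t)
    (hc : 0 < c) (hHs : 0 < Hs) (hγ : γ * Hs ≤ ‖N 0‖) (hN0 : 0 < ‖N 0‖)
    (hbound : ∀ t, Hs ≤ ‖N t‖ → |inner ℝ (N t) (N' t)| ≤ c * ‖N t‖ ^ 3 * s' t)
    (hT : 0 ≤ T) (hsT : 1 + c * s T * ‖N 0‖ < γ) :
    ‖N 0‖ ≤ ‖N T‖ * (1 + c * s T * ‖N 0‖) := by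
  have hsmono : Monotone s := monotone_of_hasDerivAt_nonneg hs hs'
  have hNc : Continuous N := continuous_iff_continuousAt.2 fun t => (hN t).continuousAt
  have hsc : Continuous s := continuous_iff_continuousAt.2 fun t => (hs t).continuousAt
  let S : Set ℝ := {t | ‖N 0‖ ≤ ‖N t‖ * (1 + c * s t * ‖N 0‖)}
  have hSc : IsClosed S := isClosed_le continuous_const (by fun_prop)
  suffices h : Set.Icc 0 T ⊆ S from h ⟨hT, le_rfl⟩
  refine (hSc.inter isClosed_Icc).Icc_subset_of_forall_mem_nhdsWithin (by simp [S, hs0]) ?_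
  rintro x ⟨hxS, hx0, hxT⟩
  have hsx : 0 ≤ s x := hs0 ▸ hsmono hx0
  have hone : 0 < 1 + c * s x * ‖N 0‖ := by positivity
  have hlt : 1 + c * s x * ‖N 0‖ < γ := by
    refine lt_of_le_of_lt ?_ hsT
    gcongr
    exact hsmono hxT.le
  -- the lower bound at `x` is strictly above the threshold `Hs`
  have hxHs : Hs < ‖N x‖ := by
    have h1 : ‖N 0‖ ≤ ‖N x‖ * (1 + c * s x * ‖N 0‖) := hxS
    have hγ0 : 0 < γ := hone.trans hlt
    by_contra! hle
    have h2 : ‖N x‖ * (1 + c * s x * ‖N 0‖) ≤ Hs * (1 + c * s x * ‖N 0‖) := by gcongr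
    have h3 : Hs * (1 + c * s x * ‖N 0‖) < Hs * γ := by gcongr
    linarith
  obtain ⟨δ, hδ, hball⟩ := Metric.eventually_nhds_iff_ball.1
    (hNc.norm.continuousAt.eventually (lt_mem_nhds hxHs))
  have hmem : Set.Ico x (x + δ) ∈ nhdsWithin x (Set.Ioi x) :=
    Filter.mem_of_superset (Ioo_mem_nhdsGT (by linarith)) Set.Ioo_subset_Ico_self
  filter_upwards [hmem] with y hy
  have hpos : ∀ t ∈ Set.Ico x (x + δ), Hs < ‖N t‖ := fun t ht =>
    hball t (by rw [Metric.mem_ball, Real.dist_eq, abs_lt]; constructor <;> linarith [ht.1, ht.2])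
  -- `1 / ‖N‖ - c s` is nonincreasing as long as `‖N‖ ≥ Hs`
  have hanti : AntitoneOn (fun t => ‖N t‖⁻¹ - c * s t) (Set.Ico x (x + δ)) := by
    have hder : ∀ t ∈ Set.Ico x (x + δ), HasDerivAt (fun t => ‖N t‖⁻¹ - c * s t)
        (-(inner ℝ (N t) (N' t) / ‖N t‖) / ‖N t‖ ^ 2 - c * s' t) t := by
      intro t ht
      have hnt : N t ≠ 0 := norm_pos_iff.1 (hHs.trans (hpos t ht))
      have h1 : HasDerivAt (fun t => ‖N t‖) (inner ℝ (N t) (N' t) / ‖N t‖) t := by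
        have h2 := (hN t).norm_sq.sqrt (by positivity)
        simp only [Real.sqrt_sq (norm_nonneg _)] at h2
        convert h2 using 1
        ring
      exact (h1.inv (norm_ne_zero_iff.2 hnt)).sub ((hs t).const_mul c)
    refine antitoneOn_of_deriv_nonpos (convex_Ico _ _)
      (fun t ht => (hder t ht).continuousAt.continuousWithinAt)
      (fun t ht => (hder t (interior_subset ht)).differentiableAt.differentiableWithinAt) ?_
    intro t ht
    have ht := interior_subset ht
    rw [(hder t ht).deriv]
    have hnt : 0 < ‖N t‖ := hHs.trans (hpos t ht)
    have h1 := neg_le_of_abs_le (hbound t (hpos t ht).le)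
    have h2 : -(inner ℝ (N t) (N' t) / ‖N t‖) / ‖N t‖ ^ 2 = -inner ℝ (N t) (N' t) / ‖N t‖ ^ 3 := by
      field_simp
    rw [h2, sub_nonpos, div_le_iff₀ (by positivity)]
    linarith
  have hxy := hanti ⟨le_rfl, by linarith⟩ hy hy.1
  simp only at hxy
  have hNx : 0 < ‖N x‖ := hHs.trans hxHs
  have hNy : 0 < ‖N y‖ := hHs.trans (hpos y hy)
  have hkey : ‖N x‖⁻¹ ≤ ‖N 0‖⁻¹ + c * s x := by
    have h1 : ‖N 0‖ ≤ ‖N x‖ * (1 + c * s x * ‖N 0‖) := hxS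
    rw [inv_le_iff_one_le_mul₀ hNx]
    have h2 : (‖N 0‖⁻¹ + c * s x) * ‖N x‖ = ‖N x‖ * (1 + c * s x * ‖N 0‖) / ‖N 0‖ := by
      field_simp
    rw [h2, le_div_iff₀ hN0]
    linarith
  have hkey' : ‖N y‖⁻¹ ≤ ‖N 0‖⁻¹ + c * s y := by linarith
  rw [inv_le_iff_one_le_mul₀ hNy] at hkey'
  have h2 : (‖N 0‖⁻¹ + c * s y) * ‖N y‖ = ‖N y‖ * (1 + c * s y * ‖N 0‖) / ‖N 0‖ := by
    field_simp
  rw [h2, le_div_iff₀ hN0] at hkey'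
  change ‖N 0‖ ≤ _
  linarith

/-- If `F` is injective near `q`, a path that ends at `q` and whose image under `F` stays close to
`F q` stays close to `q`: on the frontier of a small compact neighbourhood of `q`, the distance from
`F` to `F q` is bounded below. -/
theorem exists_forall_path_mem {M Y : Type*} [TopologicalSpace M] [T2Space M]
    [LocallyCompactSpace M] [PseudoMetricSpace Y] [T0Space Y] {F : M → Y} (hF : Continuous F)
    {q : M} {U₀ U : Set M}
    (hU₀ : U₀ ∈ nhds q) (hinj : Set.InjOn F U₀) (hU : U ∈ nhds q) :
    ∃ δ > 0, ∀ (η : ℝ → M) (a b : ℝ), Continuous η → a ≤ b → η b = q →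
      (∀ t ∈ Set.Icc a b, dist (F (η t)) (F q) < δ) → η a ∈ U := by
  obtain ⟨K, hK, hKU, hKc⟩ := local_compact_nhds (Filter.inter_mem hU₀ hU)
  have hKcl : IsClosed K := hKc.isClosed
  have hfr : IsCompact (frontier K) := hKc.of_isClosed_subset isClosed_frontier
    hKcl.frontier_subset
  have hFq : F q ∉ F '' frontier K := by
    rintro ⟨x, hx, hxq⟩
    have hxK : x ∈ K := hKcl.frontier_subset hx
    have := hinj (hKU hxK).1 (mem_of_mem_nhds hU₀) hxq
    subst this
    exact hx.2 (mem_interior_iff_mem_nhds.2 hK)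
  obtain ⟨δ, hδ, hball⟩ := Metric.mem_nhds_iff.1
    ((hfr.image hF).isClosed.isOpen_compl.mem_nhds hFq)
  refine ⟨δ, hδ, fun η a b hη hab hb hd => ?_⟩
  have hnot : ∀ t ∈ Set.Icc a b, η t ∉ frontier K := fun t ht hfrt =>
    hball (Metric.mem_ball.2 (hd t ht)) ⟨η t, hfrt, rfl⟩
  have hconn : IsPreconnected (η '' Set.Icc a b) :=
    isPreconnected_Icc.image η hη.continuousOn
  by_contra ha
  have haK : η a ∉ K := fun h => ha (hKU h).2
  obtain ⟨x, -, hxi, hxc⟩ := hconn (interior K) Kᶜ isOpen_interior hKcl.isOpen_compl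
    (by
      rintro _ ⟨t, ht, rfl⟩
      by_cases hx : η t ∈ K
      · exact Or.inl (by_contra fun h => hnot t ht ⟨subset_closure hx, h⟩)
      · exact Or.inr hx)
    ⟨q, ⟨b, ⟨hab, le_rfl⟩, hb⟩, mem_interior_iff_mem_nhds.2 hK⟩
    ⟨η a, ⟨a, ⟨le_rfl, hab⟩, rfl⟩, haK⟩
  exact hxc (interior_subset hxi)

end Comparison

/-! ### Lower bounds along almost shortest curves -/

section Curves

variable {n m : ℕ} {M : Type*} [TopologicalSpace M] [ChartedSpace (EuclideanSpace ℝ (Fin n)) M]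

theorem hasDerivAt_comp_curve {G : M → EuclideanSpace ℝ (Fin m)} {η : ℝ → M} {t : ℝ}
    (hG : MDifferentiableAt (𝓡 n) 𝓘(ℝ, EuclideanSpace ℝ (Fin m)) G (η t))
    (hη : MDifferentiableAt 𝓘(ℝ, ℝ) (𝓡 n) η t) :
    HasDerivAt (G ∘ η) (differential n G (η t) (mfderiv 𝓘(ℝ, ℝ) (𝓡 n) η t (1 : ℝ))) t := by
  let A : ℝ →L[ℝ] EuclideanSpace ℝ (Fin m) :=
    (differential n G (η t)).comp (mfderiv 𝓘(ℝ, ℝ) (𝓡 n) η t)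
  have h : HasFDerivAt (G ∘ η) A t := (hG.hasMFDerivAt.comp t hη.hasMFDerivAt).hasFDerivAt
  exact h.hasDerivAt

/-- The length of a curve in the induced metric is the Euclidean length of its image under `F`. -/
theorem exists_curve_of_intrinsicEDist_lt {F : M → EuclideanSpace ℝ (Fin m)}
    (hF : ContMDiff (𝓡 n) 𝓘(ℝ, EuclideanSpace ℝ (Fin m)) ∞ F) {p q : M} {r : ℝ}
    (h : intrinsicEDist n F p q < ENNReal.ofReal r) :
    ∃ η : ℝ → M, η 0 = p ∧ η 1 = q ∧ ContMDiff 𝓘(ℝ, ℝ) (𝓡 n) 1 η ∧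
      ∫ t in (0 : ℝ)..1, ‖deriv (F ∘ η) t‖ < r := by
  let : ∀ x : M, ENorm (TangentSpace (𝓡 n) x) := fun x => ⟨fun v => ‖differential n F x v‖ₑ⟩
  have : ∀ x : M, ENormSMulClass ℝ (TangentSpace (𝓡 n) x) := fun x => ⟨fun c v => by
    change ‖differential n F x (c • v)‖ₑ = ‖c‖ₑ * ‖differential n F x v‖ₑ
    rw [map_smul, enorm_smul]⟩
  obtain ⟨η, h0, h1, hη, hlt, -, -⟩ :=
    Manifold.exists_lt_locally_constant_of_riemannianEDist_lt (I := 𝓡 n) (x := p) (y := q) h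
      zero_lt_one
  refine ⟨η, h0, h1, hη, ?_⟩
  have hφ : ContDiff ℝ 1 (F ∘ η) := by
    rw [← contMDiff_iff_contDiff]
    exact (hF.of_le (by simp)).comp hη
  have hc : Continuous (deriv (F ∘ η)) := hφ.continuous_deriv le_rfl
  rw [Manifold.pathELength_eq_lintegral_mfderiv_Icc] at hlt
  have heq : ∀ t, ‖mfderiv 𝓘(ℝ, ℝ) (𝓡 n) η t (1 : ℝ)‖ₑ = ‖deriv (F ∘ η) t‖ₑ := by
    intro t
    rw [(hasDerivAt_comp_curve (hF.mdifferentiableAt (by simp))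
      (hη.mdifferentiableAt (by simp))).deriv]
    rfl
  have hint : MeasureTheory.IntegrableOn (deriv (F ∘ η)) (Set.Icc 0 1) :=
    hc.continuousOn.integrableOn_Icc
  replace hlt := lt_of_eq_of_lt (MeasureTheory.lintegral_congr fun t => (heq t).symm) hlt
  rw [← MeasureTheory.ofReal_integral_norm_eq_lintegral_enorm hint,
    MeasureTheory.integral_Icc_eq_integral_Ioc,
    ← intervalIntegral.integral_of_le zero_le_one] at hlt
  exact (ENNReal.ofReal_lt_ofReal_iff'.1 hlt).1

/-- The lower bound for `|H|` holds, up to an arbitrarily small error `ε` in the distance, at points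
arbitrarily close to `q`. The point is taken on an almost shortest curve from `p` to `q`, stopped
before the comparison argument reaches the end of its range: if the distance is the critical one, the
curve itself is too long for the argument to apply up to `q`. -/
theorem exists_near_norm_meanCurvature_ge [IsManifold (𝓡 n) ∞ M] [T2Space M]
    {F : M → EuclideanSpace ℝ (Fin m)}
    (hF : Manifold.IsImmersion (𝓡 n) 𝓘(ℝ, EuclideanSpace ℝ (Fin m)) ∞ F)
    {c Hs γ : ℝ} (hc : 0 < c) (hHs : 0 < Hs)
    (hgrad : ∀ p : M, Hs ≤ ‖meanCurvature n F p‖ →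
      normGradMeanCurvature n F p ≤ c * ‖meanCurvature n F p‖ ^ 2)
    (hγ : 1 < γ) {p q : M} (hp : γ * Hs ≤ ‖meanCurvature n F p‖) {d : ℝ} (hd0 : 0 ≤ d)
    (hd : intrinsicEDist n F p q = ENNReal.ofReal d)
    (hdγ : d * (c * ‖meanCurvature n F p‖) ≤ γ - 1)
    {U : Set M} (hU : U ∈ nhds q) {ε₀ : ℝ} (hε₀ : 0 < ε₀) :
    ∃ ε, 0 < ε ∧ ε ≤ ε₀ ∧ ∃ y ∈ U, ‖meanCurvature n F p‖
      ≤ ‖meanCurvature n F y‖ * (1 + c * (d + ε) * ‖meanCurvature n F p‖) := by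
  have hFs := hF.contMDiff
  have : LocallyCompactSpace M := Manifold.locallyCompact_of_finiteDimensional (𝓡 n)
  obtain ⟨U₀, hU₀, hinj⟩ := exists_nhds_injOn (hF.isImmersionAt q)
  obtain ⟨δ, hδ, hconf⟩ := exists_forall_path_mem hFs.continuous hU₀ hinj hU
  have hH0 : 0 < ‖meanCurvature n F p‖ := by nlinarith
  have hcH : 0 < c * ‖meanCurvature n F p‖ := by positivity
  set D := (γ - 1) / (c * ‖meanCurvature n F p‖) with hD
  have hD0 : 0 < D := div_pos (by linarith) hcH
  have hdD : d ≤ D := by rwa [hD, le_div_iff₀ hcH]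
  -- `ε < δ / 2`, as the part of the curve left out has length at most `2 * ε`
  obtain ⟨ε, hε, hεle⟩ : ∃ ε, 0 < ε ∧ ε ≤ ε₀ ∧ ε < δ / 2 ∧ ε < D := by
    refine ⟨min ε₀ (min (δ / 4) (D / 2)), by positivity, min_le_left _ _, ?_, ?_⟩
    · exact ((min_le_right _ _).trans (min_le_left _ _)).trans_lt (by linarith)
    · exact ((min_le_right _ _).trans (min_le_right _ _)).trans_lt (by linarith)
  refine ⟨ε, hε, hεle.1, ?_⟩
  obtain ⟨η, h0, h1, hη, hlen⟩ := exists_curve_of_intrinsicEDist_lt (r := d + ε) hFs (p := p)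
    (q := q) (by rw [hd]; exact (ENNReal.ofReal_lt_ofReal_iff (by linarith)).2 (by linarith))
  have hφ : ContDiff ℝ 1 (F ∘ η) := by
    rw [← contMDiff_iff_contDiff]
    exact (hFs.of_le (by simp)).comp hη
  have hφc : Continuous fun t => ‖deriv (F ∘ η) t‖ := (hφ.continuous_deriv le_rfl).norm
  let s : ℝ → ℝ := fun t => ∫ u in (0 : ℝ)..t, ‖deriv (F ∘ η) u‖
  have hs : ∀ t, HasDerivAt s ‖deriv (F ∘ η) t‖ t := fun t =>
    intervalIntegral.integral_hasDerivAt_right (hφc.intervalIntegrable _ _)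
      (hφc.stronglyMeasurableAtFilter _ _) hφc.continuousAt
  have hs0 : s 0 = 0 := intervalIntegral.integral_same
  have hsc : Continuous s := continuous_iff_continuousAt.2 fun t => (hs t).continuousAt
  -- stop at the time where the arc length reaches `min (s 1) (D - ε)`
  obtain ⟨T, ⟨hT0, hT1⟩, hsT⟩ : min (s 1) (D - ε) ∈ s '' Set.Icc 0 1 := by
    refine intermediate_value_Icc zero_le_one hsc.continuousOn ⟨?_, min_le_left _ _⟩
    rw [hs0]
    exact le_min (intervalIntegral.integral_nonneg zero_le_one fun _ _ => norm_nonneg _)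
      (by linarith [hεle.2.2])
  have hsTd : s T ≤ d + ε := hsT ▸ (min_le_left _ _).trans hlen.le
  have hsTD : s T ≤ D - ε := hsT ▸ min_le_right _ _
  have hrem : s 1 - s T ≤ 2 * ε := by
    rw [hsT]
    have hlen' : s 1 < d + ε := hlen
    rcases min_cases (s 1) (D - ε) with h | h <;> linarith [h.1]
  have hmono : Monotone s := monotone_of_hasDerivAt_nonneg hs fun _ => norm_nonneg _
  refine ⟨η T, hconf η T 1 hη.continuous hT1 h1 fun t ht => ?_, ?_⟩
  · have hnorm : ‖(F ∘ η) 1 - (F ∘ η) t‖ ≤ s 1 - s t := by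
      rw [intervalIntegral.integral_interval_sub_left (hφc.intervalIntegrable _ _)
        (hφc.intervalIntegrable _ _), ← intervalIntegral.integral_deriv_eq_sub
        (fun u _ => hφ.differentiable (by simp) u)
        ((hφ.continuous_deriv le_rfl).intervalIntegrable _ _)]
      exact intervalIntegral.norm_integral_le_integral_norm ht.2
    have h2 := hmono ht.1
    rw [dist_comm, dist_eq_norm, ← h1]
    exact hnorm.trans_lt (by linarith [hεle.2.1])
  · have hN : ∀ t, HasDerivAt (meanCurvature n F ∘ η)
        (differential n (meanCurvature n F) (η t) (mfderiv 𝓘(ℝ, ℝ) (𝓡 n) η t (1 : ℝ))) t :=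
      fun t => hasDerivAt_comp_curve (mdifferentiableAt_meanCurvature hF _)
        (hη.mdifferentiableAt (by simp))
    have key := norm_le_norm_mul_of_abs_inner_deriv_le (c := c) (Hs := Hs) (γ := γ) (T := T) hN hs
      hs0 (fun _ => norm_nonneg _) hc hHs (by simpa [h0] using hp) (by simpa [h0] using hH0) ?_ hT0 ?_
    · simp only [Function.comp_apply, h0] at key
      refine key.trans ?_
      gcongr
    · intro t ht
      refine (abs_inner_differential_meanCurvature_le hF _ _).trans ?_
      rw [← (hasDerivAt_comp_curve (hFs.mdifferentiableAt (by simp))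
        (hη.mdifferentiableAt (by simp))).deriv]
      calc _ ≤ ‖meanCurvature n F (η t)‖ * (c * ‖meanCurvature n F (η t)‖ ^ 2 *
            ‖deriv (F ∘ η) t‖) := by gcongr; exact hgrad _ ht
        _ = _ := by simp only [Function.comp_apply]; ring
    · simp only [Function.comp_apply, h0]
      have h3 : s T * (c * ‖meanCurvature n F p‖) < D * (c * ‖meanCurvature n F p‖) := by
        gcongr; linarith
      rw [hD, div_mul_cancel₀ _ hcH.ne'] at h3
      linarith

end Curves

end ImmersedSubmanifold

theorem mainTheorem8 {n k : ℕ} {M : Type*} [TopologicalSpace M] [T2Space M]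
    [ChartedSpace (EuclideanSpace ℝ (Fin n)) M] [IsManifold (𝓡 n) ∞ M]
    (F : M → EuclideanSpace ℝ (Fin (n + k)))
    (hF : Manifold.IsImmersion (𝓡 n) 𝓘(ℝ, EuclideanSpace ℝ (Fin (n + k))) ∞ F)
    (c Hs : ℝ) (hc : 0 < c) (hHs : 0 < Hs)
    (hgrad : ∀ p : M, Hs ≤ ‖ImmersedSubmanifold.meanCurvature n F p‖ →
      ImmersedSubmanifold.normGradMeanCurvature n F p
        ≤ c * ‖ImmersedSubmanifold.meanCurvature n F p‖ ^ 2)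
    (γ : ℝ) (hγ : 1 < γ) (p₀ : M)
    (hp₀ : γ * Hs ≤ ‖ImmersedSubmanifold.meanCurvature n F p₀‖) :
    ∀ q : M,
      ImmersedSubmanifold.intrinsicEDist n F p₀ q
        ≤ ENNReal.ofReal ((γ - 1) / (c * ‖ImmersedSubmanifold.meanCurvature n F p₀‖)) →
      ‖ImmersedSubmanifold.meanCurvature n F p₀‖ /
            (1 + c * (ImmersedSubmanifold.intrinsicEDist n F p₀ q).toReal *
              ‖ImmersedSubmanifold.meanCurvature n F p₀‖)
          ≤ ‖ImmersedSubmanifold.meanCurvature n F q‖ ∧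
        ‖ImmersedSubmanifold.meanCurvature n F p₀‖ / γ
          ≤ ‖ImmersedSubmanifold.meanCurvature n F p₀‖ /
            (1 + c * (ImmersedSubmanifold.intrinsicEDist n F p₀ q).toReal *
              ‖ImmersedSubmanifold.meanCurvature n F p₀‖) := by
  intro q hq
  have hfin : ImmersedSubmanifold.intrinsicEDist n F p₀ q ≠ ⊤ :=
    ne_top_of_le_ne_top ENNReal.ofReal_ne_top hq
  set h₀ := ‖ImmersedSubmanifold.meanCurvature n F p₀‖ with hh₀
  set d := (ImmersedSubmanifold.intrinsicEDist n F p₀ q).toReal with hd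
  have hd0 : 0 ≤ d := ENNReal.toReal_nonneg
  have hh0 : 0 < h₀ := by nlinarith
  have hch : 0 < c * h₀ := by positivity
  have hdγ : d * (c * h₀) ≤ γ - 1 := by
    rw [← le_div_iff₀ hch]
    exact ENNReal.toReal_le_of_le_ofReal (div_nonneg (by linarith) hch.le) hq
  have hone : 0 < 1 + c * d * h₀ := by positivity
  refine ⟨?_, div_le_div_of_nonneg_left hh0.le hone (by linarith)⟩
  by_contra! hlt
  obtain ⟨b, hb, hb'⟩ := exists_between hlt
  have hb0 : 0 < b := (norm_nonneg _).trans_lt hb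
  have hU : {y | ‖ImmersedSubmanifold.meanCurvature n F y‖ < b} ∈ nhds q :=
    (ImmersedSubmanifold.mdifferentiableAt_meanCurvature hF q).continuousAt.norm.eventually
      (gt_mem_nhds hb)
  rw [lt_div_iff₀ hone] at hb'
  -- `ε₀` solves `b (1 + c (d + ε₀) h₀) = h₀`
  set ε₀ := (h₀ - b * (1 + c * d * h₀)) / (b * (c * h₀)) with hε₀
  have hε₀0 : 0 < ε₀ := div_pos (by linarith) (by positivity)
  obtain ⟨ε, hε, hεle, y, hy, hge⟩ := ImmersedSubmanifold.exists_near_norm_meanCurvature_ge hF hc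
    hHs hgrad hγ hp₀ hd0 (ENNReal.ofReal_toReal hfin).symm hdγ hU hε₀0
  rw [← hh₀] at hge
  have h1 : ε₀ * (b * (c * h₀)) = h₀ - b * (1 + c * d * h₀) := by
    rw [hε₀, div_mul_cancel₀ _ (by positivity)]
  have h2 : ε * (b * (c * h₀)) ≤ ε₀ * (b * (c * h₀)) := by gcongr
  have h3 : ‖ImmersedSubmanifold.meanCurvature n F y‖ * (1 + c * (d + ε) * h₀)
      < b * (1 + c * (d + ε) * h₀) := by
    have hy' : ‖ImmersedSubmanifold.meanCurvature n F y‖ < b := hy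
    gcongr
  linarith
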